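/- For a set $\Omega\subset\mathbb R^n$ and $\bar z\in\Omega$ let $$T_\Omega(\bar z):=\limsup_{t\downarrow 0}\frac{\Omega-\bar z}{t},\qquad \widehat T_\Omega(\bar z):=\liminf_{z\to\bar z,\ z\in\Omega,\ t\downarrow 0}\frac{\Omega-z}{t},\qquad T^P_\Omega(\bar z):=\limsup_{z\to\bar z,\ z\in\Omega,\ t\downarrow 0}\frac{\Omega-z}{t}$$ be the tangent cone, the regular (Clarke) tangent cone and the paratingent cone to $\Omega$ at $\bar z$. Here $\limsup_t C_t:=\{x:\liminf_t \operatorname{dist}(x,C_t)=0\}$ and $\liminf_t C_t:=\{x:\limsup_t \operatorname{dist}(x,C_t)=0\}$ are the Painlevé–Kuratowski outer and inner limits of sets. $\Omega$ is called strictly smooth at $\bar z$ if $\widehat T_\Omega(\bar z)=T^P_\Omega(\bar z)$, and locally closed at $\bar z$ if $\Omega\cap W$ is closed for some closed neighborhood $W$ of $\bar z$. $\Omega$ is called a Lipschitz manifold of dimension $d$ around $\bar z$ if $0\le d\le n$ and there are an open neighborhood $W$ of $\bar z$ and a one-to-one mapping $\Phi$ from $W$ onto an open subset of $\mathbb R^n$,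 with $\Phi$ and $\Phi^{-1}$ continuously differentiable, such that $\Phi(\Omega\cap W)$ is the graph of a Lipschitz continuous mapping $f:U\to\mathbb R^{n-d}$ with $U\subset\mathbb R^d$ open, where $\mathbb R^n$ is identified with $\mathbb R^d\times\mathbb R^{n-d}$. **Proposition.** Assume that $\Omega\subset\mathbb R^n$ is locally closed and strictly smooth at $\bar z\in\Omega$. Then $T_\Omega(\bar z)$ is a linear subspace and, with $d:=\dim T_\Omega(\bar z)$, $\Omega$ is a Lipschitz manifold of dimension $d$ around $\bar z$. Moreover, there are an $n\times n$ permutation matrix $\tilde Q$ and open sets $V\subset\mathbb R^d$, $U\subset\mathbb R^{n-d}$ with $\tilde Q\bar z=:(\bar y,\bar x)\in V\times U$ such that $\tilde Q\Omega\cap(V\times U)$ is the graph of a Lipschitz continuous mapping $f:V\to\mathbb R^{n-d}$ which is strictly differentiable at $\bar y$. -/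

import Mathlib

open Filter Topology

namespace VarGeom

/-- Painlevé–Kuratowski outer (upper) limit of the sets `C t` along the filter `l`:
the points `x` with `liminf_t dist (x, C t) = 0`. -/
noncomputable def outerLimit {ι E : Type*} [PseudoEMetricSpace E] (l : Filter ι)
    (C : ι → Set E) : Set E :=
  {x | liminf (fun t => Metric.infEDist x (C t)) l = 0}

/-- Painlevé–Kuratowski inner (lower) limit of the sets `C t` along the filter `l`:
the points `x` with `limsup_t dist (x, C t) = 0`. -/
noncomputable def innerLimit {ι E : Type*} [PseudoEMetricSpace E] (l : Filter ι)
    (C : ι → Set E) : Set E :=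
  {x | limsup (fun t => Metric.infEDist x (C t)) l = 0}

section Cones

variable {E : Type*} [NormedAddCommGroup E] [NormedSpace ℝ E]

/-- The difference quotient set `(Ω - z) / t`. -/
def quotientSet (Ω : Set E) (z : E) (t : ℝ) : Set E :=
  (fun w => t⁻¹ • (w - z)) '' Ω

/-- The tangent (Bouligand) cone: outer limit of `(Ω - z̄) / t` as `t ↓ 0`. -/
noncomputable def tangentCone (Ω : Set E) (zbar : E) : Set E :=
  outerLimit (𝓝[>] (0 : ℝ)) (fun t => quotientSet Ω zbar t)

/-- The regular (Clarke) tangent cone: inner limit of `(Ω - z) / t` as `z → z̄` in `Ω`, `t ↓ 0`. -/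
noncomputable def regularTangentCone (Ω : Set E) (zbar : E) : Set E :=
  innerLimit (𝓝[Ω] zbar ×ˢ 𝓝[>] (0 : ℝ)) (fun p => quotientSet Ω p.1 p.2)

/-- The paratingent cone: outer limit of `(Ω - z) / t` as `z → z̄` in `Ω`, `t ↓ 0`. -/
noncomputable def paratingentCone (Ω : Set E) (zbar : E) : Set E :=
  outerLimit (𝓝[Ω] zbar ×ˢ 𝓝[>] (0 : ℝ)) (fun p => quotientSet Ω p.1 p.2)

/-- `Ω` is strictly smooth at `z̄`: the set limit of `(Ω - z) / t` as `z → z̄` in `Ω`, `t ↓ 0`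
exists, i.e. the inner and outer limits agree. -/
def StrictlySmoothAt (Ω : Set E) (zbar : E) : Prop :=
  regularTangentCone Ω zbar = paratingentCone Ω zbar

/-- `Ω` is locally closed at `z̄`: its intersection with some closed neighbourhood of `z̄`
is closed. -/
def LocallyClosedAt {X : Type*} [TopologicalSpace X] (Ω : Set X) (zbar : X) : Prop :=
  ∃ W ∈ 𝓝 zbar, IsClosed W ∧ IsClosed (Ω ∩ W)

end Cones

/-- The first `d` coordinates of a vector of `ℝⁿ`. -/
noncomputable def headCoords {d n : ℕ} (h : d ≤ n) (z : EuclideanSpace ℝ (Fin n)) :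
    EuclideanSpace ℝ (Fin d) :=
  WithLp.toLp 2 fun i => z (Fin.castLE h i)

/-- The last `n - d` coordinates of a vector of `ℝⁿ`. -/
noncomputable def tailCoords {d n : ℕ} (h : d ≤ n) (z : EuclideanSpace ℝ (Fin n)) :
    EuclideanSpace ℝ (Fin (n - d)) :=
  WithLp.toLp 2 fun j => z ⟨d + j, by have := j.isLt; omega⟩

/-- The product `V × U ⊆ ℝᵈ × ℝⁿ⁻ᵈ = ℝⁿ`. -/
def prodSet {d n : ℕ} (h : d ≤ n) (V : Set (EuclideanSpace ℝ (Fin d)))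
    (U : Set (EuclideanSpace ℝ (Fin (n - d)))) : Set (EuclideanSpace ℝ (Fin n)) :=
  {z | headCoords h z ∈ V ∧ tailCoords h z ∈ U}

/-- The graph of `f : V → ℝⁿ⁻ᵈ`, `V ⊆ ℝᵈ`, as a subset of `ℝⁿ = ℝᵈ × ℝⁿ⁻ᵈ`
(only the values of `f` on `V` matter). -/
def graphSet {d n : ℕ} (h : d ≤ n) (V : Set (EuclideanSpace ℝ (Fin d)))
    (f : EuclideanSpace ℝ (Fin d) → EuclideanSpace ℝ (Fin (n - d))) :
    Set (EuclideanSpace ℝ (Fin n)) :=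
  {z | headCoords h z ∈ V ∧ tailCoords h z = f (headCoords h z)}

/-- `Ω ⊆ ℝⁿ` is a Lipschitz manifold of dimension `d` around `z̄ ∈ Ω`: there is a
`C¹`-diffeomorphism `Φ` of an open neighbourhood `W = Φ.source` of `z̄` onto an open subset of `ℝⁿ`
such that `Φ (Ω ∩ W)` is the graph of a Lipschitz mapping `f : U → ℝⁿ⁻ᵈ`, `U ⊆ ℝᵈ` open. -/
def IsLipschitzManifoldAround {n : ℕ} (d : ℕ) (Ω : Set (EuclideanSpace ℝ (Fin n)))
    (zbar : EuclideanSpace ℝ (Fin n)) : Prop :=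
  zbar ∈ Ω ∧ ∃ h : d ≤ n,
    ∃ Φ : OpenPartialHomeomorph (EuclideanSpace ℝ (Fin n)) (EuclideanSpace ℝ (Fin n)),
      zbar ∈ Φ.source ∧ ContDiffOn ℝ 1 Φ Φ.source ∧ ContDiffOn ℝ 1 Φ.symm Φ.target ∧
      ∃ (U : Set (EuclideanSpace ℝ (Fin d)))
        (f : EuclideanSpace ℝ (Fin d) → EuclideanSpace ℝ (Fin (n - d))),
        IsOpen U ∧ (∃ K : NNReal, LipschitzOnWith K f U) ∧
        Φ '' (Ω ∩ Φ.source) = graphSet h U f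

end VarGeom

/-! ### The three cones at a point of strict smoothness -/

namespace VarGeom

section Cones

/-! The regular cone lies in the tangent cone, which lies in the paratingent cone, so strict
smoothness makes all three one set `L`. The regular cone is closed under addition because its
approximations are uniform in the base point; the paratingent cone is symmetric because base point
and target can be exchanged. Hence `L` is a subspace. Some `d = dim L` of the coordinates are
coordinates on `L`, so after a permutation `L` is the graph of a linear map `A`.

Let `P` and `Q` be the projections to the first `d` and to the other coordinates, and `M = Q - A ∘
P`. Since `M` vanishes on the paratingent cone, `‖M (w - z)‖ ≤ ε ‖w - z‖` on `Ω` near `zbar`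
(`exists_norm_map_sub_le`). So `P` is injective on `Ω` near `zbar`, with a Lipschitz inverse `g`.
Since `L` lies in the regular cone, `P` also maps `Ω` near `zbar` onto a neighbourhood of `P zbar`
(`exists_forall_exists_map_eq`): local closedness gives a minimiser of `‖y - P z‖` on `Ω`, and a
nonzero residual would shrink by moving along `L`. Thus `Ω` is locally the graph of `Q ∘ g`, and the
estimate on `M`, with `ε` arbitrary, says that its strict derivative is `A`
(`exists_lipschitz_graph`). The permutation itself is the chart of the Lipschitz manifold. -/

theorem mem_innerLimit_iff {ι E : Type*} [PseudoEMetricSpace E] {l : Filter ι}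
    {C : ι → Set E} {x : E} :
    x ∈ innerLimit l C ↔ ∀ ε > 0, ∀ᶠ t in l, Metric.infEDist x (C t) < ε := by
  unfold innerLimit
  rw [Set.mem_ofPred_eq, ← nonpos_iff_eq_zero]
  constructor
  · intro h ε hε
    exact eventually_lt_of_limsup_lt (lt_of_le_of_lt h hε)
  · intro h
    refine le_of_forall_gt fun ε hε => ?_
    obtain ⟨b, hb, hbε⟩ := exists_between hε
    exact lt_of_le_of_lt (limsup_le_of_le (h := (h b hb).mono fun _ h => h.le)) hbε

theorem mem_outerLimit_iff {ι E : Type*} [PseudoEMetricSpace E] {l : Filter ι}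
    {C : ι → Set E} {x : E} :
    x ∈ outerLimit l C ↔ ∀ ε > 0, ∃ᶠ t in l, Metric.infEDist x (C t) < ε := by
  unfold outerLimit
  rw [Set.mem_ofPred_eq, ← nonpos_iff_eq_zero]
  constructor
  · intro h ε hε
    exact frequently_lt_of_liminf_lt (h := lt_of_le_of_lt h hε)
  · intro h
    refine le_of_forall_gt fun ε hε => ?_
    obtain ⟨b, hb, hbε⟩ := exists_between hε
    exact lt_of_le_of_lt (liminf_le_of_frequently_le ((h b hb).mono fun _ h => h.le)) hbε

variable {E : Type*} [NormedAddCommGroup E] [NormedSpace ℝ E] {Ω : Set E} {zbar : E}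

/-- Clearing the denominator `t` turns membership in the cones into approximation of `z + t • v` by
points of `Ω`. For `ε ≤ 0` both sides are false. -/
theorem infEDist_quotientSet_lt_iff {z v : E} {t ε : ℝ} (ht : 0 < t) :
    Metric.infEDist v (quotientSet Ω z t) < ENNReal.ofReal ε ↔
      ∃ w ∈ Ω, ‖w - z - t • v‖ < ε * t := by
  unfold quotientSet
  rw [Metric.infEDist_lt_iff]
  simp only [Set.exists_mem_image]
  refine exists_congr fun w => and_congr_right fun _ => ?_
  have h1 : w - z - t • v = t • (t⁻¹ • (w - z) - v) := by
    rw [smul_sub, smul_inv_smul₀ ht.ne']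
  rw [edist_comm, edist_dist, dist_eq_norm, h1, norm_smul, Real.norm_of_nonneg ht.le, mul_comm ε,
    mul_lt_mul_iff_right₀ ht]
  rcases le_or_gt ε 0 with hε | hε
  · rw [ENNReal.ofReal_of_nonpos hε]
    simp only [not_lt_zero, false_iff, not_lt]
    exact hε.trans (norm_nonneg _)
  · rw [ENNReal.ofReal_lt_ofReal_iff hε]

theorem forall_ennreal_pos_iff {p : ENNReal → Prop} (hp : ∀ a b, a ≤ b → p a → p b) :
    (∀ ε > 0, p ε) ↔ ∀ ε : ℝ, 0 < ε → p (ENNReal.ofReal ε) := by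
  refine ⟨fun h ε hε => h _ (by simpa using hε), fun h ε hε => ?_⟩
  obtain ⟨b, hb, hbε⟩ := ENNReal.lt_iff_exists_nnreal_btwn.1 hε
  refine hp _ _ hbε.le ?_
  have := h b (by simpa using hb)
  simpa using this

omit [NormedSpace ℝ E] in
/-- Events along `z → zbar` in `Ω`, `t ↓ 0`, in terms of a single radius. -/
theorem eventually_nhdsWithin_prod_iff {p : E × ℝ → Prop} :
    (∀ᶠ q in 𝓝[Ω] zbar ×ˢ 𝓝[>] (0 : ℝ), p q) ↔
      ∃ δ > 0, ∀ z ∈ Ω, ‖z - zbar‖ < δ → ∀ t, 0 < t → t < δ → p (z, t) := by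
  rw [(Metric.nhdsWithin_basis_ball.prod (nhdsGT_basis (0 : ℝ))).eventually_iff]
  constructor
  · rintro ⟨⟨a, b⟩, ⟨ha, hb⟩, h⟩
    refine ⟨min a b, lt_min ha hb, fun z hz hza t ht htb => h ⟨⟨?_, hz⟩, ht, ?_⟩⟩
    · rw [Metric.mem_ball, dist_eq_norm]; exact hza.trans_le (min_le_left _ _)
    · exact htb.trans_le (min_le_right _ _)
  · rintro ⟨δ, hδ, h⟩
    refine ⟨(δ, δ), ⟨hδ, hδ⟩, ?_⟩
    rintro ⟨z, t⟩ ⟨⟨hz, hzΩ⟩, ht, ht'⟩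
    rw [Metric.mem_ball, dist_eq_norm] at hz
    exact h z hzΩ hz t ht ht'

omit [NormedSpace ℝ E] in
theorem eventually_snd_pos : ∀ᶠ q in 𝓝[Ω] zbar ×ˢ 𝓝[>] (0 : ℝ), 0 < q.2 :=
  tendsto_snd.eventually self_mem_nhdsWithin

theorem mem_regularTangentCone_iff {v : E} : v ∈ regularTangentCone Ω zbar ↔
    ∀ ε > 0, ∀ᶠ q in 𝓝[Ω] zbar ×ˢ 𝓝[>] (0 : ℝ), ∃ w ∈ Ω, ‖w - q.1 - q.2 • v‖ < ε * q.2 := by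
  rw [regularTangentCone, mem_innerLimit_iff, forall_ennreal_pos_iff]
  · refine forall₂_congr fun ε _ => eventually_congr ?_
    filter_upwards [eventually_snd_pos] with q hq using infEDist_quotientSet_lt_iff hq
  · exact fun a b hab h => h.mono fun _ h => h.trans_le hab

theorem mem_paratingentCone_iff {v : E} : v ∈ paratingentCone Ω zbar ↔
    ∀ ε > 0, ∃ᶠ q in 𝓝[Ω] zbar ×ˢ 𝓝[>] (0 : ℝ), ∃ w ∈ Ω, ‖w - q.1 - q.2 • v‖ < ε * q.2 := by
  rw [paratingentCone, mem_outerLimit_iff, forall_ennreal_pos_iff]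
  · refine forall₂_congr fun ε _ => frequently_congr ?_
    filter_upwards [eventually_snd_pos] with q hq using infEDist_quotientSet_lt_iff hq
  · exact fun a b hab h => h.mono fun _ h => h.trans_le hab

omit [NormedSpace ℝ E] in
theorem tendsto_prodMk_nhdsWithin (hz : zbar ∈ Ω) :
    Tendsto (fun t : ℝ => (zbar, t)) (𝓝[>] 0) (𝓝[Ω] zbar ×ˢ 𝓝[>] (0 : ℝ)) :=
  (tendsto_const_pure.mono_right (pure_le_nhdsWithin hz)).prodMk tendsto_id

theorem regularTangentCone_subset_tangentCone (hz : zbar ∈ Ω) :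
    regularTangentCone Ω zbar ⊆ tangentCone Ω zbar := fun _ hv =>
  mem_outerLimit_iff.2 fun ε hε =>
    ((tendsto_prodMk_nhdsWithin hz).eventually (mem_innerLimit_iff.1 hv ε hε)).frequently

theorem tangentCone_subset_paratingentCone (hz : zbar ∈ Ω) :
    tangentCone Ω zbar ⊆ paratingentCone Ω zbar := fun _ hv =>
  mem_outerLimit_iff.2 fun ε hε =>
    (tendsto_prodMk_nhdsWithin hz).frequently (mem_outerLimit_iff.1 hv ε hε)

theorem zero_mem_regularTangentCone : (0 : E) ∈ regularTangentCone Ω zbar := by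
  refine mem_regularTangentCone_iff.2 fun ε hε => eventually_nhdsWithin_prod_iff.2
    ⟨1, one_pos, fun z hz _ t ht _ => ⟨z, hz, ?_⟩⟩
  simpa using mul_pos hε ht

/-- Two steps are chained: from `z` to some `x ∈ Ω` near `z + t • v`, then from `x` along `w`. The
second is allowed because the inner limit also runs over base points. -/
theorem add_mem_regularTangentCone {v w : E} (hv : v ∈ regularTangentCone Ω zbar)
    (hw : w ∈ regularTangentCone Ω zbar) : v + w ∈ regularTangentCone Ω zbar := by
  rw [mem_regularTangentCone_iff] at *
  intro ε hε
  obtain ⟨a, ha, h1⟩ := eventually_nhdsWithin_prod_iff.1 (hv (ε / 2) (half_pos hε))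
  obtain ⟨b, hb, h2⟩ := eventually_nhdsWithin_prod_iff.1 (hw (ε / 2) (half_pos hε))
  -- The first step has length at most `(‖v‖ + ε / 2) * t`; with `‖z - zbar‖` and `t` below `b / c`,
  -- its endpoint stays within `b` of `zbar`.
  set c : ℝ := 1 + ‖v‖ + ε / 2 with hc
  have hc1 : 1 ≤ c := by have := norm_nonneg v; linarith
  have hc0 : 0 < c := one_pos.trans_le hc1
  refine eventually_nhdsWithin_prod_iff.2 ⟨min a (b / c), lt_min ha (div_pos hb hc0), ?_⟩
  intro z hz hzd t ht htd
  have htb : t * c < b := (lt_div_iff₀ hc0).1 (htd.trans_le (min_le_right _ _))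
  have hzb : ‖z - zbar‖ < b / c := hzd.trans_le (min_le_right _ _)
  obtain ⟨x, hx, hxz⟩ := h1 z hz (hzd.trans_le (min_le_left _ _)) t ht
    (htd.trans_le (min_le_left _ _))
  have hxb : ‖x - zbar‖ < b := by
    have e : x - zbar = (x - z - t • v) + t • v + (z - zbar) := by abel
    have h3 : ‖x - zbar‖ ≤ ‖x - z - t • v‖ + ‖t • v‖ + ‖z - zbar‖ := by
      rw [e]; exact norm_add₃_le
    rw [norm_smul, Real.norm_of_nonneg ht.le] at h3
    have h5 : min a (b / c) * c ≤ b := by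
      rw [← le_div_iff₀ hc0]; exact min_le_right _ _
    have h6 : (ε / 2 + ‖v‖) * t ≤ (ε / 2 + ‖v‖) * min a (b / c) := by
      gcongr
    have h7 : min a (b / c) * c = min a (b / c) + (ε / 2 + ‖v‖) * min a (b / c) := by
      rw [hc]; ring
    simp only at hxz
    linarith
  obtain ⟨y, hy, hyx⟩ := h2 x hx hxb t ht (by nlinarith)
  refine ⟨y, hy, ?_⟩
  have e : y - z - t • (v + w) = (y - x - t • w) + (x - z - t • v) := by
    rw [smul_add]; abel
  simp only at hxz hyx ⊢
  rw [e]
  refine (norm_add_le _ _).trans_lt ?_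
  linarith

theorem smul_mem_regularTangentCone {v : E} {c : ℝ} (hc : 0 < c)
    (hv : v ∈ regularTangentCone Ω zbar) : c • v ∈ regularTangentCone Ω zbar := by
  rw [mem_regularTangentCone_iff] at *
  intro ε hε
  obtain ⟨a, ha, h1⟩ := eventually_nhdsWithin_prod_iff.1 (hv (ε / c) (div_pos hε hc))
  refine eventually_nhdsWithin_prod_iff.2 ⟨min a (a / c), lt_min ha (div_pos ha hc), ?_⟩
  intro z hz hzd t ht htd
  obtain ⟨x, hx, hxz⟩ := h1 z hz (hzd.trans_le (min_le_left _ _)) (t * c) (mul_pos ht hc)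
    ((lt_div_iff₀ hc).1 (htd.trans_le (min_le_right _ _)))
  refine ⟨x, hx, ?_⟩
  simp only at hxz ⊢
  rw [smul_smul]
  refine hxz.trans_eq ?_
  field_simp

/-- Exchanging the base point `z` and the nearby target `x` reverses the direction, and `x` tends to
`zbar` along with `z`. -/
theorem neg_mem_paratingentCone {v : E} (hv : v ∈ paratingentCone Ω zbar) :
    -v ∈ paratingentCone Ω zbar := by
  rw [mem_paratingentCone_iff] at *
  intro ε hε hcon
  refine hv ε hε ?_
  obtain ⟨b, hb, h⟩ := eventually_nhdsWithin_prod_iff.1 hcon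
  set c : ℝ := 1 + ‖v‖ + ε with hc
  have hc1 : 1 ≤ c := by have := norm_nonneg v; linarith
  have hc0 : 0 < c := one_pos.trans_le hc1
  refine eventually_nhdsWithin_prod_iff.2 ⟨b / c, div_pos hb hc0, ?_⟩
  rintro z hz hzd t ht htd ⟨x, hx, hxz⟩
  simp only at hxz
  have htb : t * c < b := (lt_div_iff₀ hc0).1 htd
  refine h x hx ?_ t ht (by nlinarith) ⟨z, hz, ?_⟩
  · have e : x - zbar = (x - z - t • v) + t • v + (z - zbar) := by abel
    have h3 : ‖x - zbar‖ ≤ ‖x - z - t • v‖ + ‖t • v‖ + ‖z - zbar‖ := by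
      rw [e]; exact norm_add₃_le
    rw [norm_smul, Real.norm_of_nonneg ht.le] at h3
    have h5 : b / c * c = b := div_mul_cancel₀ _ hc0.ne'
    have h6 : (ε + ‖v‖) * t ≤ (ε + ‖v‖) * (b / c) := by gcongr
    have h7 : b / c * c = b / c + (ε + ‖v‖) * (b / c) := by
      nth_rewrite 2 [hc]; ring
    linarith
  · have e : z - x - t • -v = -(x - z - t • v) := by rw [smul_neg]; abel
    simpa only [e, norm_neg] using hxz

/-- At a point of strict smoothness the three cones agree and form a linear subspace. -/
theorem StrictlySmoothAt.exists_submodule (h : StrictlySmoothAt Ω zbar) (hz : zbar ∈ Ω) :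
    ∃ L : Submodule ℝ E, (L : Set E) = tangentCone Ω zbar ∧
      (L : Set E) = regularTangentCone Ω zbar ∧ (L : Set E) = paratingentCone Ω zbar := by
  have hneg : ∀ v ∈ regularTangentCone Ω zbar, -v ∈ regularTangentCone Ω zbar := by
    rw [StrictlySmoothAt] at h
    rw [h]
    exact fun v => neg_mem_paratingentCone
  refine ⟨⟨⟨⟨regularTangentCone Ω zbar, add_mem_regularTangentCone⟩,
    zero_mem_regularTangentCone⟩, ?_⟩, ?_, rfl, h⟩
  · intro c v hv
    rcases lt_trichotomy c 0 with hc | rfl | hc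
    · have := hneg _ (smul_mem_regularTangentCone (neg_pos.2 hc) hv)
      simpa using this
    · simpa using zero_mem_regularTangentCone
    · exact smul_mem_regularTangentCone hc hv
  · exact (regularTangentCone_subset_tangentCone hz).antisymm
      ((tangentCone_subset_paratingentCone hz).trans h.symm.subset)

end Cones

end VarGeom

/-! ### From cone conditions to a local Lipschitz graph -/

namespace VarGeom

section Graph

variable {E : Type*} [NormedAddCommGroup E] [NormedSpace ℝ E] {Ω : Set E} {zbar : E}

/-- Half of `ε` absorbs a small change of direction, so each direction has a neighbourhood with a
common radius; compactness does the rest. -/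
theorem exists_uniform_of_subset_regularTangentCone {K : Set E} (hK : IsCompact K)
    (hsub : K ⊆ regularTangentCone Ω zbar) {ε : ℝ} (hε : 0 < ε) :
    ∃ δ > 0, ∀ z ∈ Ω, ‖z - zbar‖ < δ → ∀ t, 0 < t → t < δ → ∀ v ∈ K,
      ∃ w ∈ Ω, ‖w - z - t • v‖ < ε * t := by
  have h : ∀ᶠ p in (𝓝[Ω] zbar ×ˢ 𝓝[>] (0 : ℝ)) ×ˢ 𝓝ˢ K,
      ∃ w ∈ Ω, ‖w - p.1.1 - p.1.2 • p.2‖ < ε * p.1.2 := by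
    refine hK.mem_prod_nhdsSet_of_forall fun y hy => ?_
    have h1 := mem_regularTangentCone_iff.1 (hsub hy) (ε / 2) (half_pos hε)
    have h2 : ∀ᶠ v in 𝓝 y, ‖v - y‖ < ε / 2 := by
      simpa [dist_eq_norm] using Metric.eventually_nhds_iff_ball.2
        ⟨ε / 2, half_pos hε, fun v hv => by rwa [Metric.mem_ball, dist_eq_norm] at hv⟩
    filter_upwards [(h1.and eventually_snd_pos).prod_mk h2]
    rintro ⟨⟨z, t⟩, v⟩ ⟨⟨⟨w, hw, hwz⟩, ht⟩, hv⟩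
    refine ⟨w, hw, ?_⟩
    simp only at hwz ht hv ⊢
    have e : w - z - t • v = (w - z - t • y) - t • (v - y) := by rw [smul_sub]; abel
    have h3 : ‖t • (v - y)‖ ≤ t * (ε / 2) := by
      rw [norm_smul, Real.norm_of_nonneg ht.le]; gcongr
    rw [e]
    refine (norm_sub_le _ _).trans_lt ?_
    linarith
  exact eventually_nhdsWithin_prod_iff.1 (h.curry.mono fun _ h => h.self_of_nhdsSet)

theorem exists_uniform_of_disjoint_paratingentCone {K : Set E} (hK : IsCompact K)
    (hdisj : ∀ v ∈ K, v ∉ paratingentCone Ω zbar) :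
    ∃ δ > 0, ∀ z ∈ Ω, ‖z - zbar‖ < δ → ∀ t, 0 < t → t < δ → ∀ v ∈ K, ∀ w ∈ Ω,
      w - z ≠ t • v := by
  have h : ∀ᶠ p in (𝓝[Ω] zbar ×ˢ 𝓝[>] (0 : ℝ)) ×ˢ 𝓝ˢ K,
      ∀ w ∈ Ω, w - p.1.1 ≠ p.1.2 • p.2 := by
    refine hK.mem_prod_nhdsSet_of_forall fun y hy => ?_
    have h0 := hdisj y hy
    rw [mem_paratingentCone_iff] at h0
    push Not at h0
    obtain ⟨ε, hε, h1⟩ := h0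
    have h2 : ∀ᶠ v in 𝓝 y, ‖v - y‖ < ε := by
      simpa [dist_eq_norm] using Metric.eventually_nhds_iff_ball.2
        ⟨ε, hε, fun v hv => by rwa [Metric.mem_ball, dist_eq_norm] at hv⟩
    filter_upwards [(h1.and eventually_snd_pos).prod_mk h2]
    rintro ⟨⟨z, t⟩, v⟩ ⟨⟨h3, ht⟩, hv⟩ w hw hwz
    simp only at h3 ht hv hwz
    have h4 := h3 w hw
    rw [hwz, ← smul_sub, norm_smul, Real.norm_of_nonneg ht.le, mul_comm] at h4
    exact absurd hv (not_lt.2 (le_of_mul_le_mul_left (by linarith) ht))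
  exact eventually_nhdsWithin_prod_iff.1 (h.curry.mono fun _ h => h.self_of_nhdsSet)

/-- If a linear map vanishes on the paratingent cone, it is small on differences of points of `Ω`
close to `zbar`. -/
theorem exists_norm_map_sub_le [FiniteDimensional ℝ E] {X : Type*} [NormedAddCommGroup X]
    [NormedSpace ℝ X] (M : E →L[ℝ] X) (hM : ∀ v ∈ paratingentCone Ω zbar, M v = 0)
    {ε : ℝ} (hε : 0 < ε) :
    ∃ δ > 0, ∀ z ∈ Ω, ‖z - zbar‖ < δ → ∀ w ∈ Ω, ‖w - zbar‖ < δ →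
      ‖M (w - z)‖ ≤ ε * ‖w - z‖ := by
  -- These are the unit directions violating the estimate; none is paratingent, so near `zbar` no
  -- chord of `Ω` points along them.
  have hK : IsCompact (Metric.sphere (0 : E) 1 ∩ {v | ε ≤ ‖M v‖}) :=
    have := FiniteDimensional.proper ℝ E
    (isCompact_sphere 0 1).inter_right (isClosed_le continuous_const M.continuous.norm)
  obtain ⟨δ, hδ, h⟩ := exists_uniform_of_disjoint_paratingentCone (Ω := Ω) (zbar := zbar) hK
    (by
      rintro v ⟨-, hv⟩ hv'
      have : ε ≤ ‖M v‖ := hv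
      rw [hM v hv', norm_zero] at this
      exact absurd this (not_le.2 hε))
  refine ⟨δ / 2, half_pos hδ, fun z hz hzd w hw hwd => ?_⟩
  by_contra! hcon
  have hne : w - z ≠ 0 := by
    rintro h0
    simp [h0] at hcon
  have hpos : 0 < ‖w - z‖ := norm_pos_iff.2 hne
  refine h z hz (by linarith) ‖w - z‖ hpos ?_ (‖w - z‖⁻¹ • (w - z)) ⟨?_, ?_⟩ w hw ?_
  · have e : w - z = (w - zbar) - (z - zbar) := by abel
    rw [e]
    refine (norm_sub_le _ _).trans_lt (by linarith)
  · simp [norm_smul, hpos.ne']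
  · change ε ≤ ‖M _‖
    rw [map_smul, norm_smul, norm_inv, norm_norm, inv_mul_eq_div, le_div_iff₀ hpos]
    exact hcon.le
  · rw [smul_inv_smul₀ hpos.ne']

omit [NormedSpace ℝ E] in
theorem LocallyClosedAt.exists_isClosed_inter_closedBall (h : LocallyClosedAt Ω zbar) :
    ∃ r > 0, ∀ s ≤ r, IsClosed (Ω ∩ Metric.closedBall zbar s) := by
  obtain ⟨W, hW, -, hΩW⟩ := h
  obtain ⟨r, hr, hrW⟩ := Metric.nhds_basis_closedBall.mem_iff.1 hW
  refine ⟨r, hr, fun s hs => ?_⟩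
  have : Ω ∩ Metric.closedBall zbar s = (Ω ∩ W) ∩ Metric.closedBall zbar s := by
    rw [Set.inter_assoc, Set.inter_eq_right.2 ((Metric.closedBall_subset_closedBall hs).trans hrW)]
  rw [this]
  exact hΩW.inter Metric.isClosed_closedBall

/-- A linear map which is expansive on `Ω` near `zbar` and which has a right inverse with values in
the regular tangent cone is open on `Ω` at `zbar`. -/
theorem exists_forall_exists_map_eq [FiniteDimensional ℝ E] {Y : Type*} [NormedAddCommGroup Y]
    [NormedSpace ℝ Y] [FiniteDimensional ℝ Y] (hz : zbar ∈ Ω) (hclosed : LocallyClosedAt Ω zbar)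
    (P : E →L[ℝ] Y) (R : Y →L[ℝ] E) (hPR : ∀ y, P (R y) = y)
    (hR : ∀ y, R y ∈ regularTangentCone Ω zbar) {C δ : ℝ} (hC : 0 ≤ C) (hδ : 0 < δ)
    (hexp : ∀ z ∈ Ω, ‖z - zbar‖ < δ → ‖z - zbar‖ ≤ C * ‖P (z - zbar)‖)
    {r : ℝ} (hr : 0 < r) :
    ∃ ρ > 0, ∀ y, ‖y - P zbar‖ < ρ → ∃ z ∈ Ω, ‖z - zbar‖ < r ∧ P z = y := by
  have := FiniteDimensional.proper ℝ E
  have := FiniteDimensional.proper ℝ Y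
  obtain ⟨r₁, hr₁, hcl⟩ := hclosed.exists_isClosed_inter_closedBall
  -- With `‖P‖ * ε ≤ 1 / 2`, the error of a step costs at most half of what the step gains.
  set ε : ℝ := 1 / (2 * (‖P‖ + 1)) with hεdef
  have hP0 := norm_nonneg P
  have hε : 0 < ε := by positivity
  have hPε : ‖P‖ * ε ≤ 1 / 2 := by
    rw [hεdef, mul_one_div, div_le_div_iff₀ (by positivity) two_pos]; linarith
  have hε1 : ε ≤ 1 := by
    rw [hεdef, div_le_one (by positivity)]; linarith
  obtain ⟨δ₂, hδ₂, hstep⟩ := exists_uniform_of_subset_regularTangentCone (Ω := Ω) (zbar := zbar)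
    ((isCompact_sphere (0 : Y) 1).image R.continuous)
    (by rintro _ ⟨y, -, rfl⟩; exact hR y) hε
  obtain ⟨s, hs, hsr, hsr₁, hsδ, hsδ₂⟩ : ∃ s > 0, s < r ∧ s ≤ r₁ ∧ s < δ ∧ s < δ₂ := by
    refine ⟨min (min r r₁) (min δ δ₂) / 2, by positivity, ?_⟩
    have h1 : min (min r r₁) (min δ δ₂) ≤ min r r₁ := min_le_left _ _
    have h2 : min (min r r₁) (min δ δ₂) ≤ min δ δ₂ := min_le_right _ _
    have h3 : 0 < min (min r r₁) (min δ δ₂) := by positivity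
    rw [le_min_iff] at h1 h2
    refine ⟨?_, ?_, ?_, ?_⟩ <;> linarith
  have hcomp : IsCompact (Ω ∩ Metric.closedBall zbar s) :=
    (isCompact_closedBall zbar s).of_isClosed_subset (hcl s hsr₁) Set.inter_subset_right
  -- Comparing the minimiser `z` with `zbar` gives `‖P (z - zbar)‖` below twice this radius, so
  -- `hexp` puts `z` in the ball of radius `s / 2`, leaving room to move.
  refine ⟨s / (4 * (C + 1)), by positivity, fun y hy => ?_⟩
  obtain ⟨z, ⟨hzΩ, hzs⟩, hmin⟩ := hcomp.exists_isMinOn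
    ⟨zbar, hz, Metric.mem_closedBall_self hs.le⟩
    (f := fun z => ‖y - P z‖) (by fun_prop)
  rw [Metric.mem_closedBall, dist_eq_norm] at hzs
  have hmin' : ∀ w ∈ Ω, ‖w - zbar‖ ≤ s → ‖y - P z‖ ≤ ‖y - P w‖ := fun w hw hws =>
    hmin ⟨hw, by rwa [Metric.mem_closedBall, dist_eq_norm]⟩
  have hzs2 : ‖z - zbar‖ ≤ s / 2 := by
    have h1 := hexp z hzΩ (hzs.trans_lt hsδ)
    have h2 := hmin' zbar hz (by simpa using hs.le)
    have h3 : ‖P (z - zbar)‖ ≤ ‖y - P zbar‖ + ‖y - P z‖ := by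
      rw [map_sub]
      have e : P z - P zbar = (y - P zbar) - (y - P z) := by abel
      rw [e]; exact norm_sub_le _ _
    have h4 : s / (4 * (C + 1)) * (4 * (C + 1)) = s := div_mul_cancel₀ _ (by positivity)
    have h5 : C * ‖P (z - zbar)‖ ≤ C * (2 * (s / (4 * (C + 1)))) := by
      gcongr; linarith
    have h6 : 0 < s / (4 * (C + 1)) := by positivity
    nlinarith
  refine ⟨z, hzΩ, hzs.trans_lt hsr, ?_⟩
  by_contra hne
  set m : ℝ := ‖y - P z‖ with hm
  have hmpos : 0 < m := norm_pos_iff.2 (sub_ne_zero.2 (Ne.symm hne))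
  set u : Y := m⁻¹ • (y - P z) with hu
  have hu1 : ‖u‖ = 1 := by
    rw [hu, norm_smul, norm_inv, Real.norm_of_nonneg hmpos.le, ← hm, inv_mul_cancel₀ hmpos.ne']
  have hmu : m • u = y - P z := by rw [hu, smul_inv_smul₀ hmpos.ne']
  -- A step of size `t` along `R u` removes `t` from the residual up to an error of `t / 2`,
  -- contradicting minimality. The bound `t ≤ m` prevents overshooting, and the last bound keeps the
  -- new point in the ball.
  obtain ⟨t, ht, htδ, htm, hts⟩ : ∃ t > 0, t < δ₂ ∧ t ≤ m ∧ t * (1 + ‖R u‖) ≤ s / 2 := by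
    refine ⟨min (δ₂ / 2) (min m (s / 2 / (1 + ‖R u‖))), by positivity, ?_, ?_, ?_⟩
    · exact (min_le_left _ _).trans_lt (half_lt_self hδ₂)
    · exact (min_le_right _ _).trans (min_le_left _ _)
    · rw [← le_div_iff₀ (by positivity)]
      exact (min_le_right _ _).trans (min_le_right _ _)
  obtain ⟨w, hw, hwz⟩ := hstep z hzΩ (hzs.trans_lt hsδ₂) t ht htδ (R u)
    ⟨u, by simpa using hu1, rfl⟩
  have hws : ‖w - zbar‖ ≤ s := by
    have e : w - zbar = (w - z - t • R u) + t • R u + (z - zbar) := by abel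
    have h3 : ‖w - zbar‖ ≤ ‖w - z - t • R u‖ + ‖t • R u‖ + ‖z - zbar‖ := by
      rw [e]; exact norm_add₃_le
    rw [norm_smul, Real.norm_of_nonneg ht.le] at h3
    have h4 : ε * t ≤ 1 * t := by gcongr
    linarith
  have hle := hmin' w hw hws
  have e : y - P w = (m - t) • u - P (w - z - t • R u) := by
    rw [map_sub, map_sub, map_smul, hPR, sub_smul, hmu]; abel
  have h1 : ‖y - P w‖ ≤ (m - t) + ‖P (w - z - t • R u)‖ := by
    rw [e]
    refine (norm_sub_le _ _).trans_eq ?_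
    rw [norm_smul, hu1, Real.norm_of_nonneg (sub_nonneg.2 htm), mul_one]
  have h2 : ‖P (w - z - t • R u)‖ ≤ ‖P‖ * (ε * t) :=
    (P.le_opNorm _).trans (by gcongr)
  have h3 : ‖P‖ * (ε * t) ≤ 1 / 2 * t := by
    rw [← mul_assoc]; gcongr
  linarith

/-- If the paratingent cone lies in the graph of `A` and the graph of `A` lies in the regular
tangent cone, then a locally closed set is locally the graph of a Lipschitz mapping with strict
derivative `A`. -/
theorem exists_lipschitz_graph [FiniteDimensional ℝ E] {X Y : Type*} [NormedAddCommGroup Y]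
    [NormedSpace ℝ Y] [FiniteDimensional ℝ Y] [NormedAddCommGroup X] [NormedSpace ℝ X]
    (hz : zbar ∈ Ω) (hclosed : LocallyClosedAt Ω zbar) (e : E ≃L[ℝ] Y × X) (A : Y →L[ℝ] X)
    (hpar : ∀ v ∈ paratingentCone Ω zbar, (e v).2 = A (e v).1)
    (hreg : ∀ v, (e v).2 = A (e v).1 → v ∈ regularTangentCone Ω zbar) :
    ∃ (V : Set Y) (U : Set X) (f : Y → X), IsOpen V ∧ IsOpen U ∧ (e zbar).1 ∈ V ∧
      (e zbar).2 ∈ U ∧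
      (∀ z, z ∈ Ω ∧ (e z).1 ∈ V ∧ (e z).2 ∈ U ↔ (e z).1 ∈ V ∧ (e z).2 = f (e z).1) ∧
      (∃ K : NNReal, LipschitzOnWith K f V) ∧ HasStrictFDerivAt f A (e zbar).1 := by
  set P : E →L[ℝ] Y := (ContinuousLinearMap.fst ℝ Y X).comp (e : E →L[ℝ] Y × X) with hP
  set Q : E →L[ℝ] X := (ContinuousLinearMap.snd ℝ Y X).comp (e : E →L[ℝ] Y × X) with hQ
  have hPe : ∀ z, (e z).1 = P z := fun _ => rfl
  have hQe : ∀ z, (e z).2 = Q z := fun _ => rfl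
  simp only [hPe, hQe] at *
  set N : ℝ := ‖(e.symm : Y × X →L[ℝ] E)‖ with hN
  have hN0 : 0 ≤ N := norm_nonneg _
  have hA0 := norm_nonneg A
  have hQ0 := norm_nonneg Q
  have hnorm : ∀ u, ‖u‖ ≤ N * (‖P u‖ + ‖Q u‖) := fun u => by
    have h1 := (e.symm : Y × X →L[ℝ] E).le_opNorm (P u, Q u)
    have h2 : (e.symm : Y × X →L[ℝ] E) (P u, Q u) = u := e.symm_apply_apply u
    rw [h2] at h1
    refine h1.trans ?_
    gcongr
    exact max_le_add_of_nonneg (norm_nonneg _) (norm_nonneg _)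
  set M : E →L[ℝ] X := Q - A.comp P with hM
  have hMe : ∀ u, M u = Q u - A (P u) := fun _ => rfl
  have hM0 : ∀ v ∈ paratingentCone Ω zbar, M v = 0 := fun v hv => by
    rw [hMe, hpar v hv, sub_self]
  -- The tolerance makes the contribution of `M` to `‖w - z‖` at most half of `‖w - z‖`, which is
  -- absorbed on the left in `hexp`.
  obtain ⟨δ, hδ, hδM⟩ := exists_norm_map_sub_le M hM0 (ε := 1 / (2 * (N + 1))) (by positivity)
  set C : ℝ := 2 * (N * (1 + ‖A‖)) with hC
  have hC0 : 0 ≤ C := by positivity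
  have hexp : ∀ z ∈ Ω, ‖z - zbar‖ < δ → ∀ w ∈ Ω, ‖w - zbar‖ < δ →
      ‖w - z‖ ≤ C * ‖P (w - z)‖ := by
    intro z hz hzd w hw hwd
    have h1 := hδM z hz hzd w hw hwd
    have h2 := hnorm (w - z)
    have h3 : ‖Q (w - z)‖ ≤ ‖M (w - z)‖ + ‖A‖ * ‖P (w - z)‖ := by
      have : Q (w - z) = M (w - z) + A (P (w - z)) := by rw [hMe]; abel
      rw [this]
      exact (norm_add_le _ _).trans (by gcongr; exact A.le_opNorm _)
    have h4 : N * (1 / (2 * (N + 1)) * ‖w - z‖) ≤ 1 / 2 * ‖w - z‖ := by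
      rw [← mul_assoc]
      gcongr
      rw [mul_one_div, div_le_div_iff₀ (by positivity) two_pos]; linarith
    have h5 : N * (‖P (w - z)‖ + ‖Q (w - z)‖) ≤ N * (‖P (w - z)‖ +
      (1 / (2 * (N + 1)) * ‖w - z‖ + ‖A‖ * ‖P (w - z)‖)) := by
      gcongr; linarith
    rw [hC]
    linarith
  set s : ℝ := δ / (2 * (N + 1)) with hs
  have hs0 : 0 < s := by positivity
  have hbox : ∀ z, ‖P z - P zbar‖ < s → ‖Q z - Q zbar‖ < s → ‖z - zbar‖ < δ := by
    intro z h1 h2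
    have h3 := hnorm (z - zbar)
    rw [map_sub, map_sub] at h3
    have h4 : s * (2 * (N + 1)) = δ := div_mul_cancel₀ _ (by positivity)
    have h5 : N * (‖P z - P zbar‖ + ‖Q z - Q zbar‖) ≤ N * (s + s) := by gcongr
    linarith
  set R : Y →L[ℝ] E := (e.symm : Y × X →L[ℝ] E).comp ((ContinuousLinearMap.id ℝ Y).prod A)
    with hR
  have heR : ∀ y, e (R y) = (y, A y) := fun y => e.apply_symm_apply _
  have hPR : ∀ y, P (R y) = y := fun y => congrArg Prod.fst (heR y)
  have hQR : ∀ y, Q (R y) = A y := fun y => congrArg Prod.snd (heR y)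
  obtain ⟨ρ, hρ, hsurj⟩ := exists_forall_exists_map_eq hz hclosed P R hPR
    (fun y => hreg _ (by rw [hPR, hQR])) hC0 hδ
    (fun z hzΩ hzd => hexp zbar hz (by simpa using hδ) z hzΩ hzd)
    -- The first bound keeps the preimages where `hexp` applies, the second keeps their
    -- `Q`-component in the box of radius `s`.
    (r := min δ (s / (‖Q‖ + 1))) (by positivity)
  choose! g hgΩ hgd hgP using hsurj
  have hgδ : ∀ y, ‖y - P zbar‖ < ρ → ‖g y - zbar‖ < δ := fun y hy =>
    (hgd y hy).trans_le (min_le_left _ _)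
  have hgQ : ∀ y, ‖y - P zbar‖ < ρ → ‖Q (g y) - Q zbar‖ < s := fun y hy => by
    rw [← map_sub]
    have h1 := Q.le_opNorm (g y - zbar)
    have h2 := (hgd y hy).trans_le (min_le_right _ _)
    have h3 : s / (‖Q‖ + 1) * (‖Q‖ + 1) = s := div_mul_cancel₀ _ (by positivity)
    have h4 : ‖Q‖ * ‖g y - zbar‖ ≤ ‖Q‖ * (s / (‖Q‖ + 1)) := by gcongr
    have h5 : 0 < s / (‖Q‖ + 1) := by positivity
    linarith
  have hgexp : ∀ y, ‖y - P zbar‖ < ρ → ∀ y', ‖y' - P zbar‖ < ρ →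
      ‖g y - g y'‖ ≤ C * ‖y - y'‖ := fun y hy y' hy' => by
    have h := hexp _ (hgΩ y' hy') (hgδ y' hy') _ (hgΩ y hy) (hgδ y hy)
    rwa [map_sub, hgP y hy, hgP y' hy'] at h
  have huniq : ∀ z ∈ Ω, ‖z - zbar‖ < δ → ‖P z - P zbar‖ < ρ → z = g (P z) := fun z hzΩ hzd hzρ => by
    have h := hexp _ (hgΩ _ hzρ) (hgδ _ hzρ) z hzΩ hzd
    rw [map_sub, hgP _ hzρ, sub_self, norm_zero, mul_zero] at h
    exact sub_eq_zero.1 (norm_le_zero_iff.1 h)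
  have hgz : g (P zbar) = zbar := (huniq zbar hz (by simpa using hδ) (by simpa using hρ)).symm
  refine ⟨Metric.ball (P zbar) (min ρ s), Metric.ball (Q zbar) s, fun y => Q (g y),
    Metric.isOpen_ball, Metric.isOpen_ball, Metric.mem_ball_self (by positivity),
    Metric.mem_ball_self hs0, fun z => ?_, ?_, ?_⟩
  · simp only [Metric.mem_ball, dist_eq_norm, lt_min_iff]
    constructor
    · rintro ⟨hzΩ, ⟨h1, h2⟩, h3⟩
      refine ⟨⟨h1, h2⟩, ?_⟩
      rw [← huniq z hzΩ (hbox z h2 h3) h1]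
    · rintro ⟨⟨h1, h2⟩, h3⟩
      have : z = g (P z) := e.injective (Prod.ext (hgP _ h1).symm h3)
      refine ⟨?_, ⟨h1, h2⟩, ?_⟩
      · rw [this]; exact hgΩ _ h1
      · rw [h3]; exact hgQ _ h1
  · refine ⟨Real.toNNReal (‖Q‖ * C), LipschitzOnWith.of_dist_le_mul fun y hy y' hy' => ?_⟩
    rw [Metric.mem_ball, dist_eq_norm, lt_min_iff] at hy hy'
    rw [Real.coe_toNNReal _ (by positivity), dist_eq_norm, dist_eq_norm, ← map_sub, mul_assoc]
    exact (Q.le_opNorm _).trans (by gcongr; exact hgexp y hy.1 y' hy'.1)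
  -- The remainder of `f = Q ∘ g` with respect to `A` is exactly `M (g y - g y')`, and `g` is
  -- `C`-Lipschitz.
  · refine .of_isLittleO (Asymptotics.isLittleO_iff.2 fun ε hε => ?_)
    obtain ⟨η, hη, hηM⟩ := exists_norm_map_sub_le M hM0 (ε := ε / (C + 1)) (by positivity)
    have hev : ∀ᶠ y in 𝓝 (P zbar), ‖y - P zbar‖ < ρ ∧ ‖g y - zbar‖ < η := by
      refine Metric.eventually_nhds_iff_ball.2 ⟨min ρ (η / (C + 1)), by positivity, fun y hy => ?_⟩
      rw [Metric.mem_ball, dist_eq_norm, lt_min_iff, lt_div_iff₀ (by positivity)] at hy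
      have h := hgexp y hy.1 (P zbar) (by simpa using hρ)
      rw [hgz] at h
      exact ⟨hy.1, by nlinarith [norm_nonneg (y - P zbar)]⟩
    rw [nhds_prod_eq]
    filter_upwards [hev.prod_mk hev]
    rintro ⟨y, y'⟩ ⟨⟨h1, h2⟩, h3, h4⟩
    simp only at h1 h2 h3 h4 ⊢
    have h5 := hηM _ (hgΩ y' h3) h4 _ (hgΩ y h1) h2
    rw [hMe, map_sub, map_sub, hgP y h1, hgP y' h3] at h5
    refine h5.trans ?_
    calc ε / (C + 1) * ‖g y - g y'‖ ≤ ε / (C + 1) * (C * ‖y - y'‖) := by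
          gcongr; exact hgexp y h1 y' h3
      _ ≤ ε / (C + 1) * ((C + 1) * ‖y - y'‖) := by gcongr; linarith
      _ = ε * ‖y - y'‖ := by field_simp

end Graph

end VarGeom

/-! ### Choice of coordinates and linear identifications -/

namespace VarGeom

/-- Some `d` of the coordinates are coordinates on a given `d`-dimensional subspace of `ℝⁿ`. -/
theorem exists_perm_head_injective {n d : ℕ} (L : Submodule ℝ (EuclideanSpace ℝ (Fin n)))
    (hd : Module.finrank ℝ L = d) (h : d ≤ n) :
    ∃ σ : Equiv.Perm (Fin n), ∀ x ∈ L, (∀ i, x (σ (Fin.castLE h i)) = 0) → x = 0 := by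
  -- The coordinate functionals restricted to `L` separate points, hence so does a basis of their
  -- span chosen among them; its indices become the first `d` coordinates.
  let c : Fin n → Module.Dual ℝ L := fun i =>
    (EuclideanSpace.proj (𝕜 := ℝ) i : EuclideanSpace ℝ (Fin n) →L[ℝ] ℝ).toLinearMap ∘ₗ L.subtype
  have hc : ∀ i (x : L), c i x = (x : EuclideanSpace ℝ (Fin n)) i := fun _ _ => rfl
  have key := Submodule.exists_fun_fin_finrank_span_eq ℝ (Set.range c)
  have hinj : ∀ (m : ℕ) (f : Fin m → Module.Dual ℝ L),
      Submodule.span ℝ (Set.range f) = Submodule.span ℝ (Set.range c) →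
      ∀ x : L, (∀ i, f i x = 0) → x = 0 := by
    intro m f hspan x hx
    have hle : Submodule.span ℝ (Set.range f) ≤ LinearMap.ker (Module.Dual.eval ℝ L x) := by
      rw [Submodule.span_le]
      rintro _ ⟨i, rfl⟩
      exact hx i
    ext i
    rw [← hc]
    exact hle (hspan ▸ Submodule.subset_span (Set.mem_range_self i))
  have hfin : Module.finrank ℝ (Submodule.span ℝ (Set.range c)) = d := by
    refine le_antisymm ?_ ?_
    · rw [← hd, ← Subspace.dual_finrank_eq (K := ℝ) (V := L)]
      exact Submodule.finrank_le _
    -- A separating family of `m` functionals embeds `L` into `ℝᵐ`, so `d ≤ m`.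
    · obtain ⟨f, -, hspan, -⟩ := key
      have hpi : Function.Injective (LinearMap.pi f) := by
        rw [injective_iff_map_eq_zero]
        exact fun x hx => hinj _ f hspan x fun i => congrFun hx i
      have := LinearMap.finrank_le_finrank_of_injective hpi
      rwa [hd, Module.finrank_fin_fun] at this
  rw [hfin] at key
  obtain ⟨f, hf, hspan, hind⟩ := key
  choose κ hκ using hf
  have hκinj : Function.Injective κ := fun i j hij =>
    hind.injective (by rw [← hκ, ← hκ, hij])
  obtain ⟨σ, hσ⟩ := Equiv.Perm.exists_extending_pair (Fin.castLE h) κ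
    (Fin.castLE_injective h) hκinj
  refine ⟨σ, fun x hx h0 => ?_⟩
  refine congrArg Subtype.val (hinj d f hspan ⟨x, hx⟩ fun i => ?_)
  rw [← hκ, hc, ← hσ]
  exact h0 i

/-- The identification `ℝⁿ = ℝᵈ × ℝⁿ⁻ᵈ`. -/
noncomputable def splitCoords {d n : ℕ} (h : d ≤ n) : EuclideanSpace ℝ (Fin n) ≃L[ℝ]
    EuclideanSpace ℝ (Fin d) × EuclideanSpace ℝ (Fin (n - d)) :=
  (LinearMap.linearEquivOfInjective
    (V := EuclideanSpace ℝ (Fin n))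
    (V₂ := EuclideanSpace ℝ (Fin d) × EuclideanSpace ℝ (Fin (n - d)))
    { toFun := fun z => (headCoords h z, tailCoords h z)
      map_add' := by intros; rfl
      map_smul' := by intros; rfl }
    (fun z w hzw => by
      replace hzw : headCoords h z = headCoords h w ∧ tailCoords h z = tailCoords h w :=
        Prod.mk.inj hzw
      ext i
      rcases lt_or_ge (i : ℕ) d with hi | hi
      · exact congrArg (fun v : EuclideanSpace ℝ (Fin d) => v ⟨i, hi⟩) hzw.1
      · have := congrArg (fun v : EuclideanSpace ℝ (Fin (n - d)) => v ⟨i - d, by omega⟩) hzw.2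
        simpa [tailCoords, Nat.add_sub_cancel' hi] using this)
    (by simp [Nat.add_sub_cancel' h])).toContinuousLinearEquiv

theorem splitCoords_apply {d n : ℕ} (h : d ≤ n) (z : EuclideanSpace ℝ (Fin n)) :
    splitCoords h z = (headCoords h z, tailCoords h z) := rfl

theorem toEuclideanLin_permMatrix_apply {n : ℕ} (σ : Equiv.Perm (Fin n))
    (z : EuclideanSpace ℝ (Fin n)) (i : Fin n) :
    Matrix.toEuclideanLin (σ.permMatrix ℝ) z i = z (σ i) := by
  simp [Matrix.toLpLin_apply, Matrix.permMatrix_mulVec]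

/-- The action of a permutation matrix, as an equivalence. -/
noncomputable def permEquiv {n : ℕ} (σ : Equiv.Perm (Fin n)) :
    EuclideanSpace ℝ (Fin n) ≃L[ℝ] EuclideanSpace ℝ (Fin n) :=
  (LinearIsometryEquiv.piLpCongrLeft 2 ℝ ℝ σ.symm).toContinuousLinearEquiv

theorem permEquiv_apply {n : ℕ} (σ : Equiv.Perm (Fin n)) (z : EuclideanSpace ℝ (Fin n)) :
    permEquiv σ z = Matrix.toEuclideanLin (σ.permMatrix ℝ) z := by
  ext i
  rw [toEuclideanLin_permMatrix_apply]
  rfl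

/-- A subspace on which the first component is injective and whose dimension is that of the first
factor is the graph of a linear map. -/
theorem exists_eq_graph {E X Y : Type*} [NormedAddCommGroup E] [NormedSpace ℝ E]
    [NormedAddCommGroup Y] [NormedSpace ℝ Y] [FiniteDimensional ℝ Y] [NormedAddCommGroup X]
    [NormedSpace ℝ X] [FiniteDimensional ℝ E] (e : E ≃L[ℝ] Y × X) (L : Submodule ℝ E)
    (hinj : ∀ x ∈ L, (e x).1 = 0 → x = 0) (hdim : Module.finrank ℝ L = Module.finrank ℝ Y) :
    ∃ A : Y →L[ℝ] X, ∀ v, v ∈ L ↔ (e v).2 = A (e v).1 := by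
  let p : L →ₗ[ℝ] Y := LinearMap.fst ℝ Y X ∘ₗ e.toLinearEquiv.toLinearMap ∘ₗ L.subtype
  have hp : ∀ x : L, p x = (e x).1 := fun _ => rfl
  have hpinj : Function.Injective p := by
    rw [injective_iff_map_eq_zero]
    exact fun x hx => Subtype.ext (hinj x x.2 hx)
  let q := LinearMap.linearEquivOfInjective p hpinj hdim
  have hq : ∀ x : L, q x = (e x).1 := fun _ => rfl
  refine ⟨LinearMap.toContinuousLinearMap (LinearMap.snd ℝ Y X ∘ₗ e.toLinearEquiv.toLinearMap ∘ₗ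
    L.subtype ∘ₗ q.symm.toLinearMap), fun v => ?_⟩
  change _ ↔ (e v).2 = (e (q.symm (e v).1 : L)).2
  constructor
  · intro hv
    rw [← hq ⟨v, hv⟩, q.symm_apply_apply]
  · intro hv
    have h1 : (e (q.symm (e v).1 : L)).1 = (e v).1 := by rw [← hq, q.apply_symm_apply]
    have h2 : v = (q.symm (e v).1 : L) := e.injective (Prod.ext h1.symm hv)
    rw [h2]
    exact (q.symm (e v).1).2

theorem isOpen_prodSet {d n : ℕ} (h : d ≤ n) {V : Set (EuclideanSpace ℝ (Fin d))}
    {U : Set (EuclideanSpace ℝ (Fin (n - d)))} (hV : IsOpen V) (hU : IsOpen U) :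
    IsOpen (prodSet h V U) :=
  (hV.prod hU).preimage (splitCoords h).continuous

/-- A set whose image under a linear equivalence is, within an open product, a Lipschitz graph is a
Lipschitz manifold. -/
theorem isLipschitzManifoldAround_of_image_inter_eq {d n : ℕ} (h : d ≤ n)
    {Ω : Set (EuclideanSpace ℝ (Fin n))} {zbar : EuclideanSpace ℝ (Fin n)} (hz : zbar ∈ Ω)
    (T : EuclideanSpace ℝ (Fin n) ≃L[ℝ] EuclideanSpace ℝ (Fin n))
    {V : Set (EuclideanSpace ℝ (Fin d))} {U : Set (EuclideanSpace ℝ (Fin (n - d)))}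
    {f : EuclideanSpace ℝ (Fin d) → EuclideanSpace ℝ (Fin (n - d))} (hV : IsOpen V)
    (hU : IsOpen U) (hmem : T zbar ∈ prodSet h V U)
    (hgraph : (T '' Ω) ∩ prodSet h V U = graphSet h V f) {K : NNReal}
    (hf : LipschitzOnWith K f V) : IsLipschitzManifoldAround d Ω zbar := by
  have hW : IsOpen (T ⁻¹' prodSet h V U) := (isOpen_prodSet h hV hU).preimage T.continuous
  refine ⟨hz, h, T.toHomeomorph.toOpenPartialHomeomorph.restrOpen _ hW, ?_, ?_, ?_, V, f, hV,
    ⟨K, hf⟩, ?_⟩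
  · exact ⟨trivial, hmem⟩
  · exact T.contDiff.contDiffOn
  · exact T.symm.contDiff.contDiffOn
  · rw [← hgraph, ← Set.image_inter_preimage]
    simp only [OpenPartialHomeomorph.restrOpen_source, Homeomorph.toOpenPartialHomeomorph_source,
      Set.univ_inter]
    rfl

end VarGeom

/-! ### Assembly in the permuted coordinates -/

theorem mainTheorem5 (n : ℕ) (Ω : Set (EuclideanSpace ℝ (Fin n)))
    (zbar : EuclideanSpace ℝ (Fin n)) (hz : zbar ∈ Ω)
    (hclosed : VarGeom.LocallyClosedAt Ω zbar)
    (hsmooth : VarGeom.StrictlySmoothAt Ω zbar) :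
    ∃ (L : Submodule ℝ (EuclideanSpace ℝ (Fin n))) (d : ℕ),
      (L : Set (EuclideanSpace ℝ (Fin n))) = VarGeom.tangentCone Ω zbar ∧
      Module.finrank ℝ L = d ∧
      VarGeom.IsLipschitzManifoldAround d Ω zbar ∧
      ∃ (h : d ≤ n) (σ : Equiv.Perm (Fin n))
        (V : Set (EuclideanSpace ℝ (Fin d))) (U : Set (EuclideanSpace ℝ (Fin (n - d))))
        (f : EuclideanSpace ℝ (Fin d) → EuclideanSpace ℝ (Fin (n - d))),
        IsOpen V ∧ IsOpen U ∧
        Matrix.toEuclideanLin (σ.permMatrix ℝ) zbar ∈ VarGeom.prodSet h V U ∧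
        (Matrix.toEuclideanLin (σ.permMatrix ℝ) '' Ω) ∩ VarGeom.prodSet h V U =
          VarGeom.graphSet h V f ∧
        (∃ K : NNReal, LipschitzOnWith K f V) ∧
        ∃ f' : EuclideanSpace ℝ (Fin d) →L[ℝ] EuclideanSpace ℝ (Fin (n - d)),
          HasStrictFDerivAt f f'
            (VarGeom.headCoords h (Matrix.toEuclideanLin (σ.permMatrix ℝ) zbar)) := by
  obtain ⟨L, hT, hreg, hpar⟩ := hsmooth.exists_submodule hz
  obtain ⟨d, hd⟩ : ∃ d, Module.finrank ℝ L = d := ⟨_, rfl⟩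
  have h : d ≤ n := by
    have := Submodule.finrank_le L
    rwa [hd, finrank_euclideanSpace_fin] at this
  obtain ⟨σ, hσ⟩ := VarGeom.exists_perm_head_injective L hd h
  let e := (VarGeom.permEquiv σ).trans (VarGeom.splitCoords h)
  have he : ∀ z, e z = (VarGeom.headCoords h (Matrix.toEuclideanLin (σ.permMatrix ℝ) z),
      VarGeom.tailCoords h (Matrix.toEuclideanLin (σ.permMatrix ℝ) z)) := fun z => by
    rw [← VarGeom.permEquiv_apply]
    rfl
  obtain ⟨A, hA⟩ := VarGeom.exists_eq_graph e L
    (fun x hx hx0 => hσ x hx fun i => by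
      rw [he] at hx0
      rw [← VarGeom.toEuclideanLin_permMatrix_apply]
      exact congrArg (fun v : EuclideanSpace ℝ (Fin d) => v i) hx0)
    (by rw [hd, finrank_euclideanSpace_fin])
  obtain ⟨V, U, f, hV, hU, hzV, hzU, hgraph, ⟨K, hK⟩, hstrict⟩ :=
    VarGeom.exists_lipschitz_graph hz hclosed e A
      (fun v hv => (hA v).1 (by rwa [← hpar] at hv))
      (fun v hv => by rw [← hreg]; exact (hA v).2 hv)
  simp only [he] at hzV hzU hgraph hstrict
  have himage : (Matrix.toEuclideanLin (σ.permMatrix ℝ) '' Ω) ∩ VarGeom.prodSet h V U =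
      VarGeom.graphSet h V f := by
    ext w
    obtain ⟨z, rfl⟩ : ∃ z, Matrix.toEuclideanLin (σ.permMatrix ℝ) z = w :=
      ⟨(VarGeom.permEquiv σ).symm w, by
        rw [← VarGeom.permEquiv_apply, ContinuousLinearEquiv.apply_symm_apply]⟩
    have hinj : Function.Injective (Matrix.toEuclideanLin (σ.permMatrix ℝ)) := fun x y hxy =>
      (VarGeom.permEquiv σ).injective (by rwa [VarGeom.permEquiv_apply, VarGeom.permEquiv_apply])
    rw [Set.mem_inter_iff, hinj.mem_set_image]
    exact hgraph z
  refine ⟨L, d, hT, hd, ?_, h, σ, V, U, f, hV, hU, ⟨hzV, hzU⟩, himage, ⟨K, hK⟩, A, hstrict⟩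
  refine VarGeom.isLipschitzManifoldAround_of_image_inter_eq h hz (VarGeom.permEquiv σ) hV hU
    (f := f) ?_ ?_ hK
  · rw [VarGeom.permEquiv_apply]
    exact ⟨hzV, hzU⟩
  · simpa only [VarGeom.permEquiv_apply] using himage
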